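/- Let $T>0$ and let $L^2=L^2(\mathbb R^d)$ be the space of (real- or complex-valued) square integrable functions. Let $\mathcal L$ be a closed, densely defined linear operator on $L^2$ with domain $D$ which generates a $C_0$-semigroup on $L^2$; $D$ carries the graph norm. Let $f\in C([0,T];L^2)$ be Lipschitz continuous in $t$, let $g\in D$, and let $q\in L^\infty(\mathbb R^d)\cap C(\mathbb R^d)$. For a potential $p:\mathbb R^d\to\mathbb R$ (or $\mathbb C$) consider the problem $$(P_p)\qquad \partial_t u-\mathcal L u+p(x)\,u=f \ \text{ on } (0,T]\times\mathbb R^d,\qquad u(0,\cdot)=g .$$ A solution of $(P_p)$ is a function $u\in C([0,T];D)$ with $u(0)=g$ that is absolutely continuous as an $L^2$-valued function and that, for almost every $t\in[0,T]$, is differentiable at $t$ in $L^2$ and satisfies the equation (almost everywhere in $x$). A mollifying net is $\varphi_\varepsilon(x)=l(\varepsilon)^{-d}\varphi(x/l(\varepsilon))$, $\varepsilon\in(0,1]$, with $\varphi\in C_0^\infty(\mathbb R^d)$, $\varphi\ge 0$, $\int\varphi\,dx=1$, and $l$ positive with $l(\varepsilon)\to0$ as $\varepsilon\to0$. A net $(u_\varepsilon)_{\varepsilon\in(0,1]}\subset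 C([0,T];D)$ is a very weak solution of $(P_q)$ if there is a mollifying net such that for every $\varepsilon\in(0,1]$ the function $u_\varepsilon$ is a solution of $(P_{q_\varepsilon})$ with $q_\varepsilon=q*\varphi_\varepsilon$, and if $(u_\varepsilon)$ is moderate, i.e. there are $N\in\mathbb N_0$ and $C>0$ with $\sup_{t\in[0,T]}\|u_\varepsilon(t)\|_{L^2}\le C\varepsilon^{-N}$ for all $\varepsilon\in(0,1]$. **Theorem (Consistency).** Let $v\in C([0,T];D)$ be the solution of $(P_q)$ and let $(u_\varepsilon)_{\varepsilon\in(0,1]}$ be a very weak solution of $(P_q)$. Then $$\|u_\varepsilon-v\|_{C([0,T];L^2)}=\sup_{t\in[0,T]}\|u_\varepsilon(t)-v(t)\|_{L^2}\to0\qquad\text{as }\varepsilon\to0 .$$ -/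

import Mathlib

open MeasureTheory Filter Topology Set
open scoped NNReal ENNReal ContDiff

noncomputable section

namespace VeryWeak

/-- The space `ℝ^d`. -/
abbrev Rd (d : ℕ) : Type := EuclideanSpace ℝ (Fin d)

/-- The space `L²(ℝ^d)` of (classes of) square integrable scalar functions. -/
abbrev L2 (𝕜 : Type*) [RCLike 𝕜] (d : ℕ) : Type _ := Lp 𝕜 2 (volume : Measure (Rd d))

/-! ### Semigroups and their generators -/

/-- `S` is a `C₀`-semigroup (strongly continuous one-parameter semigroup) of bounded operators. -/
structure IsC0Semigroup {𝕜 X : Type*} [RCLike 𝕜] [NormedAddCommGroup X] [NormedSpace 𝕜 X]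
    (S : ℝ≥0 → X →L[𝕜] X) : Prop where
  map_zero : S 0 = ContinuousLinearMap.id 𝕜 X
  map_add : ∀ s t, S (s + t) = (S s).comp (S t)
  strong_continuity : ∀ x, Tendsto (fun t => S t x) (𝓝[>] 0) (𝓝 x)

/-- `L` is the infinitesimal generator of `S`: its domain consists of the `x` for which
`(S t x - x) / t` converges as `t ↓ 0`, and `L x` is that limit. -/
def IsGenerator {𝕜 X : Type*} [RCLike 𝕜] [NormedAddCommGroup X] [NormedSpace 𝕜 X]
    (L : X →ₗ.[𝕜] X) (S : ℝ≥0 → X →L[𝕜] X) : Prop :=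
  ∀ x y, (x, y) ∈ L.graph ↔
    Tendsto (fun t : ℝ≥0 => (((t : ℝ)⁻¹ : ℝ) : 𝕜) • (S t x - x)) (𝓝[>] 0) (𝓝 y)

/-- The hypothesis on the operator: `L`, with domain `L.domain ⊆ X`, is a closed, densely defined
linear operator that generates a `C₀`-semigroup on `X`. -/
structure IsAdmissible {𝕜 X : Type*} [RCLike 𝕜] [NormedAddCommGroup X] [NormedSpace 𝕜 X]
    (L : X →ₗ.[𝕜] X) : Prop where
  isClosed : L.IsClosed
  dense_domain : Dense (L.domain : Set X)
  generates : ∃ S : ℝ≥0 → X →L[𝕜] X, IsC0Semigroup S ∧ IsGenerator L S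

/-! ### The initial value problem -/

/-- `u` is a solution in `C([0,T]; D)`, `D = L.domain` with the graph norm, of
`∂ₜ u - L u + q u = f` on `(0,T]`, `u(0) = g`: it is absolutely continuous as an `L²`-valued
function and at almost every time it is differentiable and satisfies the equation (which is an
equation between functions of `x`, up to null sets). -/
structure IsSolution {𝕜 : Type*} [RCLike 𝕜] {d : ℕ} {T : ℝ} (hT : 0 < T)
    (L : L2 𝕜 d →ₗ.[𝕜] L2 𝕜 d) (q : Rd d → 𝕜) (f : C(Icc (0 : ℝ) T, L2 𝕜 d)) (g : L2 𝕜 d)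
    (u : C(Icc (0 : ℝ) T, L2 𝕜 d)) : Prop where
  mem_domain : ∀ t, u t ∈ L.domain
  continuous_graph : Continuous fun t => L ⟨u t, mem_domain t⟩
  absolutelyContinuous : AbsolutelyContinuousOnInterval (IccExtend hT.le u) 0 T
  initial : u ⟨0, left_mem_Icc.2 hT.le⟩ = g
  equation : ∀ᵐ t : ℝ, ∀ ht : t ∈ Icc (0 : ℝ) T, ∃ w : L2 𝕜 d,
    HasDerivWithinAt (IccExtend hT.le u) w (Icc 0 T) t ∧
    ∀ᵐ x : Rd d, w x - (L ⟨u ⟨t, ht⟩, mem_domain ⟨t, ht⟩⟩) x + q x * (u ⟨t, ht⟩) x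
      = (f ⟨t, ht⟩) x

/-! ### Regularization and very weak solutions -/

/-- A mollifier: a nonnegative test function with integral one. -/
structure IsMollifier {d : ℕ} (φ : Rd d → ℝ) : Prop where
  smooth : ContDiff ℝ ∞ φ
  compactSupport : HasCompactSupport φ
  nonneg : ∀ x, 0 ≤ φ x
  integral_eq_one : ∫ x, φ x = 1

/-- A scale: a positive function `l` on `(0,1]` with `l(ε) → 0` as `ε → 0`. -/
structure IsScale (l : ℝ → ℝ) : Prop where
  pos : ∀ ε ∈ Ioc (0 : ℝ) 1, 0 < l ε
  tendsto_zero : Tendsto l (𝓝[>] 0) (𝓝 0)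

/-- The mollifying net `φ_ε(x) = l(ε)^(-d) φ(x / l(ε))`. -/
def mollifyingNet {d : ℕ} (φ : Rd d → ℝ) (l : ℝ → ℝ) (ε : ℝ) (x : Rd d) : ℝ :=
  ((l ε) ^ d)⁻¹ * φ ((l ε)⁻¹ • x)

/-- The regularizing net `q_ε = φ_ε ∗ q = q ∗ φ_ε` of a (locally integrable) function `q`. -/
def regularizingNet {𝕜 : Type*} [RCLike 𝕜] {d : ℕ} (q : Rd d → 𝕜) (φ : Rd d → ℝ) (l : ℝ → ℝ)
    (ε : ℝ) : Rd d → 𝕜 :=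
  convolution (mollifyingNet φ l ε) q (ContinuousLinearMap.lsmul ℝ ℝ) volume

/-- A net `(b_ε)`, `ε ∈ (0,1]`, in a normed space is moderate if `‖b_ε‖ ≤ C ε^(-N)` for some `N`
and `C`. The values of `b` outside `(0,1]` play no role. -/
def IsModerate {B : Type*} [NormedAddCommGroup B] (b : ℝ → B) : Prop :=
  ∃ N : ℕ, ∃ C : ℝ, 0 < C ∧ ∀ ε ∈ Ioc (0 : ℝ) 1, ‖b ε‖ ≤ C * (ε ^ N)⁻¹

/-- The net `(u_ε)`, `ε ∈ (0,1]`, is a very weak solution of the initial value problem with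
potential the (locally integrable) function `q`. -/
def IsVeryWeakSolution {𝕜 : Type*} [RCLike 𝕜] {d : ℕ} {T : ℝ} (hT : 0 < T)
    (L : L2 𝕜 d →ₗ.[𝕜] L2 𝕜 d) (q : Rd d → 𝕜) (f : C(Icc (0 : ℝ) T, L2 𝕜 d)) (g : L2 𝕜 d)
    (u : ℝ → C(Icc (0 : ℝ) T, L2 𝕜 d)) : Prop :=
  (∃ (φ : Rd d → ℝ) (l : ℝ → ℝ), IsMollifier φ ∧ IsScale l ∧
    ∀ ε ∈ Ioc (0 : ℝ) 1, IsSolution hT L (regularizingNet q φ l ε) f g (u ε)) ∧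
  IsModerate u

end VeryWeak

end

/-! The difference `w = u ε - v` satisfies `w' = L w - q_ε w + (q - q_ε) v`, `w 0 = 0`. If `M`
bounds the semigroup on `[0,T]` and `K` bounds `|q|`, hence every `|q_ε|`, variation of constants
gives `‖w t‖ ≤ A_ε + M K ∫₀ᵗ ‖w‖` with `A_ε = M ∫₀ᵀ ‖(q - q_ε) v‖`. Grönwall then bounds `‖w‖` by a
multiple of `A_ε` independent of `ε` (`IsSolution.norm_sub_le`).

Since `v` does not depend on `ε`, pointwise convergence `q_ε → q`, which continuity of `q` provides,
is enough for `A_ε → 0`: dominated convergence in `x`, then in time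
(`tendsto_integral_norm_lp_smul_zero`).

Variation of constants is a mean value inequality for `r ↦ S (t - r) (w r)`, which needs a right
derivative at every time. Solutions have one because they are absolutely continuous and the equation
equates their derivative a.e. with a continuous function. -/

namespace VeryWeak

/-! ### Strongly continuous semigroups -/

section Semigroup

variable {𝕜 X : Type*} [RCLike 𝕜] [NormedAddCommGroup X] [NormedSpace 𝕜 X]
  {S : ℝ≥0 → X →L[𝕜] X}

namespace IsC0Semigroup

theorem tendsto_nhds_zero (hS : IsC0Semigroup S) (x : X) :
    Tendsto (fun t => S t x) (𝓝 0) (𝓝 x) := by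
  have h0 : (𝓝 (0 : ℝ≥0)) = pure 0 ⊔ 𝓝[>] 0 := by
    rw [← nhdsNE_sup_pure, sup_comm]
    congr 2
    ext t
    simp [pos_iff_ne_zero]
  rw [h0, tendsto_sup]
  refine ⟨?_, hS.strong_continuity x⟩
  rw [tendsto_pure_left]
  intro s hs
  simpa [hS.map_zero] using mem_of_mem_nhds hs

/-- Otherwise there are times `t n → 0` with `‖S (t n)‖ > n`, although every orbit `S (t n) x`
converges and so is bounded; this contradicts Banach–Steinhaus. -/
theorem exists_bound_near_zero [CompleteSpace X] (hS : IsC0Semigroup S) :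
    ∃ δ > 0, ∃ M : ℝ, ∀ t ≤ δ, ‖S t‖ ≤ M := by
  by_contra! H
  have hpos : ∀ n : ℕ, (0 : ℝ≥0) < 1 / (n + 1) := fun n => by positivity
  choose t ht hM using fun n : ℕ => H (1 / (n + 1)) (hpos n) n
  have ht0 : Tendsto t atTop (𝓝 0) :=
    tendsto_of_tendsto_of_tendsto_of_le_of_le tendsto_const_nhds
      tendsto_one_div_add_atTop_nhds_zero_nat (fun _ => zero_le) ht
  obtain ⟨C, hC⟩ := banach_steinhaus (g := fun n => S (t n)) fun x => by
    obtain ⟨C, hC⟩ := ((hS.tendsto_nhds_zero x).comp ht0).norm.bddAbove_range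
    exact ⟨C, fun n => hC ⟨n, rfl⟩⟩
  obtain ⟨n, hn⟩ := exists_nat_gt C
  linarith [hM n, hC n]

theorem exists_bound [CompleteSpace X] (hS : IsC0Semigroup S) (T : ℝ≥0) :
    ∃ M : ℝ, 0 ≤ M ∧ ∀ t ≤ T, ‖S t‖ ≤ M := by
  obtain ⟨δ, hδ, M, hM⟩ := hS.exists_bound_near_zero
  have hM0 : 0 ≤ M := (norm_nonneg _).trans (hM 0 zero_le)
  have key : ∀ n : ℕ, ∃ C : ℝ, 0 ≤ C ∧ ∀ t ≤ (n : ℝ≥0) * δ, ‖S t‖ ≤ C := by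
    intro n
    induction n with
    | zero => exact ⟨M, hM0, fun t ht => hM t (ht.trans (by simp))⟩
    | succ n ih =>
      obtain ⟨C, hC0, hC⟩ := ih
      refine ⟨max C (C * M), le_max_of_le_left hC0, fun t ht => ?_⟩
      rcases le_total t (n * δ) with h | h
      · exact (hC t h).trans (le_max_left _ _)
      · refine le_trans ?_ (le_max_right _ _)
        have hsub : t - n * δ ≤ δ := by
          rw [tsub_le_iff_left]
          refine ht.trans (le_of_eq ?_)
          push_cast
          ring
        rw [← add_tsub_cancel_of_le h, hS.map_add]
        exact (ContinuousLinearMap.opNorm_comp_le _ _).trans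
          (mul_le_mul (hC _ le_rfl) (hM _ hsub) (norm_nonneg _) hC0)
  obtain ⟨n, hn⟩ := exists_nat_ge (T / δ)
  obtain ⟨C, hC0, hC⟩ := key n
  exact ⟨C, hC0, fun t ht => hC t (ht.trans ((div_le_iff₀ hδ).1 hn))⟩

/-- Factoring out the operator at the smaller time reduces continuity at any time, from either side,
to continuity at `0`. -/
theorem norm_apply_sub_apply_le (hS : IsC0Semigroup S) {T : ℝ≥0} {M : ℝ}
    (hM : ∀ t ≤ T, ‖S t‖ ≤ M) {a b : ℝ≥0} (ha : a ≤ T) (hb : b ≤ T) (x : X) :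
    ‖S a x - S b x‖ ≤ M * ‖S (nndist a b) x - x‖ := by
  wlog hab : b ≤ a generalizing a b
  · rw [norm_sub_rev, nndist_comm]
    exact this hb ha (le_of_not_ge hab)
  have hd : nndist a b = a - b := by rw [NNReal.nndist_eq, tsub_eq_zero_of_le hab, max_eq_left zero_le]
  rw [hd]
  have hsum : S a x = S b (S (a - b) x) := by
    conv_lhs => rw [← add_tsub_cancel_of_le hab, hS.map_add]
    rfl
  rw [hsum, ← map_sub]
  exact (S b).le_of_opNorm_le (hM b hb) _

theorem tendsto_apply [CompleteSpace X] (hS : IsC0Semigroup S) {α : Type*} {l : Filter α}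
    {a : α → ℝ≥0} {a₀ : ℝ≥0} (ha : Tendsto a l (𝓝 a₀)) {x : α → X} {x₀ : X}
    (hx : Tendsto x l (𝓝 x₀)) : Tendsto (fun i => S (a i) (x i)) l (𝓝 (S a₀ x₀)) := by
  obtain ⟨M, hM0, hM⟩ := hS.exists_bound (a₀ + 1)
  have hd : Tendsto (fun i => nndist (a i) a₀) l (𝓝 0) := by
    simpa using ha.nndist (tendsto_const_nhds (x := a₀))
  have hlim : Tendsto (fun i => M * ‖x i - x₀‖ + M * ‖S (nndist (a i) a₀) x₀ - x₀‖) l (𝓝 0) := by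
    have h1 : Tendsto (fun i => x i - x₀) l (𝓝 0) := by simpa using hx.sub_const x₀
    have h2 : Tendsto (fun i => S (nndist (a i) a₀) x₀ - x₀) l (𝓝 0) := by
      simpa using ((hS.tendsto_nhds_zero x₀).comp hd).sub_const x₀
    simpa using (h1.norm.const_mul M).add (h2.norm.const_mul M)
  rw [tendsto_iff_norm_sub_tendsto_zero]
  refine squeeze_zero' (Eventually.of_forall fun _ => norm_nonneg _) ?_ hlim
  filter_upwards [ha.eventually (eventually_le_nhds (show a₀ < a₀ + 1 by simp))] with i hi
  calc ‖S (a i) (x i) - S a₀ x₀‖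
      = ‖S (a i) (x i - x₀) + (S (a i) x₀ - S a₀ x₀)‖ := by rw [map_sub]; abel_nf
    _ ≤ ‖S (a i) (x i - x₀)‖ + ‖S (a i) x₀ - S a₀ x₀‖ := norm_add_le _ _
    _ ≤ _ := add_le_add ((S (a i)).le_of_opNorm_le (hM _ hi) _)
        (hS.norm_apply_sub_apply_le hM hi (by simp) x₀)

end IsC0Semigroup

theorem IsGenerator.tendsto_real [NormedSpace ℝ X] [IsScalarTower ℝ 𝕜 X] {L : X →ₗ.[𝕜] X}
    (hL : IsGenerator L S) {x y : X} (hxy : (x, y) ∈ L.graph) :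
    Tendsto (fun k : ℝ => k⁻¹ • (S k.toNNReal x - x)) (𝓝[>] 0) (𝓝 y) := by
  have hk : Tendsto Real.toNNReal (𝓝[>] 0) (𝓝[>] 0) := by
    refine tendsto_nhdsWithin_iff.2 ⟨?_, ?_⟩
    · simpa using (continuous_real_toNNReal.tendsto 0).mono_left nhdsWithin_le_nhds
    · filter_upwards [self_mem_nhdsWithin] with k hk
      simpa using hk
  refine (((hL x y).1 hxy).comp hk).congr' ?_
  filter_upwards [self_mem_nhdsWithin] with k hk
  rw [RCLike.real_smul_eq_coe_smul (K := 𝕜)]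
  simp [Real.coe_toNNReal k (le_of_lt hk)]

/-- The variation of constants formula, differentiated: `s ↦ S (t - s) (w s)` has right derivative
`S (t - s) (y s)` if `w' = L w + y`. -/
theorem hasDerivWithinAt_semigroup_apply [CompleteSpace X] [NormedSpace ℝ X] [IsScalarTower ℝ 𝕜 X]
    {L : X →ₗ.[𝕜] X} (hS : IsC0Semigroup S) (hL : IsGenerator L S) {w : ℝ → X} {s t : ℝ}
    (hst : s < t) {z y : X} (hz : (w s, z) ∈ L.graph)
    (hw : HasDerivWithinAt w (z + y) (Ici s) s) :
    HasDerivWithinAt (fun r => S (t - r).toNNReal (w r)) (S (t - s).toNNReal y) (Ici s) s := by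
  rw [← hasDerivWithinAt_Ioi_iff_Ici, hasDerivWithinAt_iff_tendsto_slope' (by simp)] at hw ⊢
  have hshift : Tendsto (fun r => r - s) (𝓝[>] s) (𝓝[>] 0) := by
    refine tendsto_nhdsWithin_iff.2 ⟨?_, ?_⟩
    · have : Tendsto (fun r => r - s) (𝓝 s) (𝓝 (s - s)) :=
        tendsto_id.sub_const s
      simpa using this.mono_left nhdsWithin_le_nhds
    · filter_upwards [self_mem_nhdsWithin] with r hr
      simpa using hr
  -- Since `S (t - s) = S (t - r) S (r - s)`, the slope to be studied is `S (t - r)` applied to the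
  -- slope of `w` minus the generator quotient at `w s`. The terms `z` cancel in the limit and leave
  -- `y`.
  have hquot := hw.sub ((hL.tendsto_real hz).comp hshift)
  rw [add_sub_cancel_left] at hquot
  have htime : Tendsto (fun r => (t - r).toNNReal) (𝓝[>] s) (𝓝 (t - s).toNNReal) := by
    have : Continuous fun r => (t - r).toNNReal := by fun_prop
    exact (this.tendsto s).mono_left nhdsWithin_le_nhds
  refine (hS.tendsto_apply htime hquot).congr' ?_
  filter_upwards [self_mem_nhdsWithin, Ioo_mem_nhdsGT hst] with r hr hrt
  have hsum : (t - s).toNNReal = (t - r).toNNReal + (r - s).toNNReal := by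
    rw [← Real.toNNReal_add (by linarith [hrt.2]) (by linarith [hrt.1])]
    congr 1
    ring
  rw [slope_def_module, slope_def_module, hsum, hS.map_add]
  simp only [Function.comp_apply, ContinuousLinearMap.comp_apply]
  rw [← smul_sub, sub_sub_sub_cancel_right, ← map_sub,
    RCLike.real_smul_eq_coe_smul (K := 𝕜), RCLike.real_smul_eq_coe_smul (K := 𝕜), map_smul]

/-- The estimate that the variation of constants formula gives for `w' = L w + y`, `w 0 = 0`. -/
theorem norm_le_integral_of_deriv_right [CompleteSpace X] [NormedSpace ℝ X] [IsScalarTower ℝ 𝕜 X]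
    {L : X →ₗ.[𝕜] X} (hS : IsC0Semigroup S) (hL : IsGenerator L S) {T M : ℝ}
    (hM : ∀ t ≤ T.toNNReal, ‖S t‖ ≤ M) {w z y : ℝ → X} (hw0 : w 0 = 0) (hwc : Continuous w)
    (hyc : Continuous y) (hz : ∀ s ∈ Ico 0 T, (w s, z s) ∈ L.graph)
    (hw : ∀ s ∈ Ico 0 T, HasDerivWithinAt w (z s + y s) (Ici s) s) {t : ℝ} (ht : t ∈ Icc 0 T) :
    ‖w t‖ ≤ M * ∫ s in (0 : ℝ)..t, ‖y s‖ := by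
  have hcont : Continuous fun r => S (t - r).toNNReal (w r) :=
    continuous_iff_continuousAt.2 fun r =>
      hS.tendsto_apply (Continuous.tendsto (by fun_prop) r) (hwc.tendsto r)
  have hB : ∀ s, HasDerivAt (fun s => M * ∫ r in (0 : ℝ)..s, ‖y r‖) (M * ‖y s‖) s := fun s =>
    (hyc.norm.integral_hasStrictDerivAt 0 s).hasDerivAt.const_mul M
  -- With `t` fixed, the function vanishes at `r = 0` and equals `w t` at `r = t`.
  have := image_norm_le_of_norm_deriv_right_le_deriv_boundary
    (f := fun r => S (t - r).toNNReal (w r)) (f' := fun s => S (t - s).toNNReal (y s))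
    (a := 0) (b := t) hcont.continuousOn
    (fun s hs => hasDerivWithinAt_semigroup_apply hS hL hs.2 (hz s ⟨hs.1, hs.2.trans_le ht.2⟩)
      (hw s ⟨hs.1, hs.2.trans_le ht.2⟩)) (by simp [hw0]) hB
    (fun s hs => (S _).le_of_opNorm_le
      (hM _ (Real.toNNReal_le_toNNReal (by linarith [hs.1, ht.2]))) _)
    (right_mem_Icc.2 ht.1)
  simpa [hS.map_zero] using this

end Semigroup

/-! ### Real analysis -/

/-- A Grönwall inequality in integral form. -/
theorem le_of_le_add_mul_integral {φ : ℝ → ℝ} (hφ : Continuous φ) (hφ0 : ∀ t, 0 ≤ φ t)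
    {A C T : ℝ} (hC : 0 ≤ C) (h : ∀ t ∈ Icc 0 T, φ t ≤ A + C * ∫ s in (0 : ℝ)..t, φ s)
    {t : ℝ} (ht : t ∈ Icc 0 T) : φ t ≤ A + C * gronwallBound 0 C A T := by
  have hA : 0 ≤ A := by
    simpa using (hφ0 0).trans (h 0 (left_mem_Icc.2 (ht.1.trans ht.2)))
  have hd : ∀ t, HasDerivAt (fun t => ∫ s in (0 : ℝ)..t, φ s) (φ t) t := fun t =>
    (hφ.integral_hasStrictDerivAt 0 t).hasDerivAt
  have hI : ∀ t, 0 ≤ t → 0 ≤ ∫ s in (0 : ℝ)..t, φ s := fun t ht =>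
    intervalIntegral.integral_nonneg ht fun s _ => hφ0 s
  -- The differential Grönwall inequality is applied to the primitive of `φ`, which starts at `0`
  -- and has derivative `φ ≤ A + C ∫ φ`.
  have := norm_le_gronwallBound_of_norm_deriv_right_le (δ := 0) (K := C) (ε := A) (a := 0) (b := T)
    (fun s _ => (hd s).continuousAt.continuousWithinAt) (fun s _ => (hd s).hasDerivWithinAt)
    (by simp) (fun s hs => by
      rw [Real.norm_of_nonneg (hφ0 s), Real.norm_of_nonneg (hI s hs.1)]
      linarith [h s ⟨hs.1, hs.2.le⟩]) t ht
  rw [Real.norm_of_nonneg (hI t ht.1), sub_zero] at this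
  have hmono := gronwallBound_mono le_rfl hA hC ht.2
  calc φ t ≤ A + C * ∫ s in (0 : ℝ)..t, φ s := h t ht
    _ ≤ _ := by gcongr; exact this.trans hmono

/-- An absolutely continuous function whose derivative is almost everywhere equal to a continuous
function is continuously differentiable. -/
theorem hasDerivWithinAt_of_ae_of_absolutelyContinuous {F : Type*} [NormedAddCommGroup F]
    [NormedSpace ℝ F] [CompleteSpace F] {T : ℝ} {w r : ℝ → F} (hr : Continuous r)
    (hw : AbsolutelyContinuousOnInterval w 0 T)
    (hd : ∀ᵐ t : ℝ, t ∈ Icc 0 T → HasDerivWithinAt w (r t) (Icc 0 T) t)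
    {s : ℝ} (hs : s ∈ Ico 0 T) : HasDerivWithinAt w (r s) (Ici s) s := by
  have hT : 0 ≤ T := hs.1.trans hs.2.le
  have hI : ∀ t, HasDerivAt (fun t => ∫ s in (0 : ℝ)..t, r s) (r t) t := fun t =>
    (hr.integral_hasStrictDerivAt 0 t).hasDerivAt
  have hIac : AbsolutelyContinuousOnInterval (fun t => ∫ s in (0 : ℝ)..t, r s) 0 T := by
    refine (ContDiff.contDiffOn ?_).absolutelyContinuousOnInterval
    rw [contDiff_one_iff_deriv]
    refine ⟨fun t => (hI t).differentiableAt, ?_⟩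
    rwa [show deriv (fun t => ∫ s in (0 : ℝ)..t, r s) = r from funext fun t => (hI t).deriv]
  -- The endpoints are discarded because a derivative within `Icc 0 T` is a full derivative only at
  -- interior points.
  obtain ⟨c, hc⟩ := (hw.sub hIac).const_of_ae_hasDerivAt_zero (by
    filter_upwards [hd, compl_mem_ae_iff.2 (measure_singleton (0 : ℝ)),
      compl_mem_ae_iff.2 (measure_singleton T)] with t ht h0 h1 hmem
    rw [uIcc_of_le hT] at hmem
    have hnhds : Icc 0 T ∈ 𝓝 t :=
      Icc_mem_nhds (lt_of_le_of_ne hmem.1 (Ne.symm h0)) (lt_of_le_of_ne hmem.2 h1)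
    simpa using ((ht hmem).hasDerivAt hnhds).sub (hI t))
  rw [uIcc_of_le hT] at hc
  have heq : ∀ t ∈ Icc 0 T, w t = c + ∫ s in (0 : ℝ)..t, r s := fun t ht => by
    rw [← hc t ht]; simp
  refine ((hI s).const_add c).hasDerivWithinAt.congr_of_eventuallyEq ?_ (heq s ⟨hs.1, hs.2.le⟩)
  filter_upwards [self_mem_nhdsWithin, nhdsWithin_le_nhds (Iio_mem_nhds hs.2)] with t ht ht'
  exact heq t ⟨hs.1.trans ht, le_of_lt ht'⟩

/-! ### Mollification -/

section Mollification

variable {d : ℕ} {φ : Rd d → ℝ} {l : ℝ → ℝ}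

theorem mollifyingNet_nonneg (hφ : IsMollifier φ) {ε : ℝ} (hl : 0 < l ε) (x : Rd d) :
    0 ≤ mollifyingNet φ l ε x :=
  mul_nonneg (by positivity) (hφ.nonneg _)

theorem continuous_mollifyingNet (hφ : IsMollifier φ) (ε : ℝ) :
    Continuous (mollifyingNet φ l ε) := by
  have := hφ.smooth.continuous
  unfold mollifyingNet
  fun_prop

theorem hasCompactSupport_mollifyingNet (hφ : IsMollifier φ) {ε : ℝ} (hl : 0 < l ε) :
    HasCompactSupport (mollifyingNet φ l ε) :=
  (hφ.compactSupport.comp_smul (inv_ne_zero hl.ne')).mul_left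

theorem integral_mollifyingNet (hφ : IsMollifier φ) {ε : ℝ} (hl : 0 < l ε) :
    ∫ x, mollifyingNet φ l ε x = 1 := by
  unfold mollifyingNet
  rw [integral_const_mul, Measure.integral_comp_inv_smul_of_nonneg _ _ hl.le, hφ.integral_eq_one]
  have : l ε ^ d ≠ 0 := by positivity
  simp [this]

theorem tendsto_support_mollifyingNet (hφ : IsMollifier φ) (hl : IsScale l) :
    Tendsto (fun ε => Function.support (mollifyingNet φ l ε)) (𝓝[>] 0) (𝓝 0).smallSets := by
  obtain ⟨R, hR⟩ := hφ.compactSupport.isBounded.exists_norm_le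
  -- The bound `R` need not be positive, and it is divided by below.
  have hR' : 0 < max R 0 + 1 := by positivity
  rw [tendsto_smallSets_iff]
  intro t ht
  obtain ⟨δ, hδ, hball⟩ := Metric.mem_nhds_iff.1 ht
  filter_upwards [hl.tendsto_zero.eventually (eventually_lt_nhds (div_pos hδ hR')),
    Ioc_mem_nhdsGT zero_lt_one] with ε hε hmem x hx
  have hpos := hl.pos ε hmem
  refine hball ?_
  have hx' : (l ε)⁻¹ • x ∈ tsupport φ := subset_tsupport _ (right_ne_zero_of_mul hx)
  have h1 := hR _ hx'
  rw [norm_smul, norm_inv, Real.norm_of_nonneg hpos.le, inv_mul_le_iff₀ hpos] at h1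
  rw [lt_div_iff₀ hR'] at hε
  rw [mem_ball_zero_iff]
  calc ‖x‖ ≤ l ε * R := h1
    _ ≤ l ε * (max R 0 + 1) := by gcongr; linarith [le_max_left R 0]
    _ < δ := hε

variable {𝕜 : Type*} [RCLike 𝕜] {q : Rd d → 𝕜}

theorem continuous_regularizingNet (hφ : IsMollifier φ) {ε : ℝ} (hl : 0 < l ε)
    (hq : Continuous q) : Continuous (regularizingNet q φ l ε) :=
  (hasCompactSupport_mollifyingNet hφ hl).continuous_convolution_left _
    (continuous_mollifyingNet hφ ε) hq.locallyIntegrable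

/-- The mollifier is a probability density, so convolution with it averages `q`. -/
theorem norm_regularizingNet_le (hφ : IsMollifier φ) {ε : ℝ} (hl : 0 < l ε) {K : ℝ}
    (hK : ∀ x, ‖q x‖ ≤ K) (x : Rd d) : ‖regularizingNet q φ l ε x‖ ≤ K := by
  have hint : Integrable (mollifyingNet φ l ε) :=
    (continuous_mollifyingNet hφ ε).integrable_of_hasCompactSupport
      (hasCompactSupport_mollifyingNet hφ hl)
  calc ‖regularizingNet q φ l ε x‖ ≤ ∫ y, mollifyingNet φ l ε y * K := by
        refine norm_integral_le_of_norm_le (hint.mul_const K) (Eventually.of_forall fun y => ?_)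
        rw [ContinuousLinearMap.lsmul_apply, norm_smul,
          Real.norm_of_nonneg (mollifyingNet_nonneg hφ hl y)]
        exact mul_le_mul_of_nonneg_left (hK _) (mollifyingNet_nonneg hφ hl y)
    _ = K := by rw [integral_mul_const, integral_mollifyingNet hφ hl, one_mul]

theorem tendsto_regularizingNet (hφ : IsMollifier φ) (hl : IsScale l) (hq : Continuous q)
    (x : Rd d) : Tendsto (fun ε => regularizingNet q φ l ε x) (𝓝[>] 0) (𝓝 (q x)) := by
  have hpos : ∀ᶠ ε in 𝓝[>] (0 : ℝ), 0 < l ε := by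
    filter_upwards [Ioc_mem_nhdsGT zero_lt_one] with ε hε using hl.pos ε hε
  refine convolution_tendsto_right (g := fun _ => q) (k := fun _ => x) (x₀ := x)
    (hpos.mono fun ε h => mollifyingNet_nonneg hφ h)
    (hpos.mono fun ε h => integral_mollifyingNet hφ h) (tendsto_support_mollifyingNet hφ hl)
    (Eventually.of_forall fun _ => hq.aestronglyMeasurable) ?_ tendsto_const_nhds
  exact (hq.tendsto x).comp tendsto_snd

end Mollification

/-! ### Multiplication operators on `L²` -/

section Multiplication

variable {𝕜 α : Type*} [RCLike 𝕜] [MeasurableSpace α] {μ : Measure α}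

theorem norm_toLp_top_le {q : α → 𝕜} (hq : MemLp q ∞ μ) {K : ℝ} (hK0 : 0 ≤ K)
    (hK : ∀ x, ‖q x‖ ≤ K) : ‖hq.toLp q‖ ≤ K := by
  rw [Lp.norm_toLp]
  refine ENNReal.toReal_le_of_le_ofReal hK0 ?_
  rw [eLpNorm_exponent_top]
  exact eLpNormEssSup_le_of_ae_bound (Eventually.of_forall hK)

theorem continuous_lp_smul (Q : Lp 𝕜 ∞ μ) : Continuous fun w : Lp 𝕜 2 μ => (Q • w : Lp 𝕜 2 μ) := by
  have hlip : LipschitzWith ‖Q‖₊ fun w : Lp 𝕜 2 μ => (Q • w : Lp 𝕜 2 μ) := by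
    refine LipschitzWith.of_dist_le_mul fun a b => ?_
    rw [dist_eq_norm, dist_eq_norm, sub_eq_add_neg, ← Lp.smul_neg, ← Lp.add_smul (r := 2),
      ← sub_eq_add_neg]
    exact Lp.norm_smul_le _ _
  exact hlip.continuous

/-- If `b_i → 0` pointwise and boundedly, then `b_i w → 0` in `L²`. -/
theorem tendsto_lp_smul_zero {ι : Type*} {l : Filter ι} [l.IsCountablyGenerated]
    {Q : ι → Lp 𝕜 ∞ μ} {b : ι → α → 𝕜} (hQ : ∀ᶠ i in l, Q i =ᵐ[μ] b i) {K : ℝ}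
    (hb : ∀ᶠ i in l, ∀ x, ‖b i x‖ ≤ K) (hlim : ∀ x, Tendsto (fun i => b i x) l (𝓝 0))
    (w : Lp 𝕜 2 μ) : Tendsto (fun i => ‖(Q i • w : Lp 𝕜 2 μ)‖) l (𝓝 0) := by
  have hnorm : ∀ F : Lp 𝕜 2 μ, ‖F‖ ^ 2 = ∫ x, ‖F x‖ ^ 2 ∂μ := fun F => by
    have h := congrArg RCLike.re (L2.inner_def (𝕜 := 𝕜) F F)
    rw [inner_self_eq_norm_sq, ← integral_re (L2.integrable_inner F F)] at h
    simpa only [inner_self_eq_norm_sq] using h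
  have hsq : Tendsto (fun i => ‖(Q i • w : Lp 𝕜 2 μ)‖ ^ 2) l (𝓝 0) := by
    have hfun : ∀ᶠ i in l, ∫ x, ‖b i x‖ ^ 2 * ‖w x‖ ^ 2 ∂μ = ‖(Q i • w : Lp 𝕜 2 μ)‖ ^ 2 := by
      filter_upwards [hQ] with i hi
      rw [hnorm]
      refine integral_congr_ae ?_
      filter_upwards [hi, Lp.coeFn_lpSMul (r := 2) (Q i) w] with x hx hs
      rw [hs, Pi.smul_apply', hx, smul_eq_mul, norm_mul, mul_pow]
    refine Tendsto.congr' hfun ?_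
    rw [← integral_zero α ℝ (μ := μ)]
    refine tendsto_integral_filter_of_dominated_convergence (fun x => K ^ 2 * ‖w x‖ ^ 2)
      ?_ ?_
      (((memLp_two_iff_integrable_sq_norm (Lp.aestronglyMeasurable w)).1 (Lp.memLp w)).const_mul _)
      (Eventually.of_forall fun x => ?_)
    · filter_upwards [hQ] with i hi
      exact (((Lp.aestronglyMeasurable (Q i)).congr hi).norm.pow 2).mul
        ((Lp.aestronglyMeasurable w).norm.pow 2)
    · filter_upwards [hb] with i hbi
      refine Eventually.of_forall fun x => ?_
      rw [Real.norm_of_nonneg (by positivity)]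
      gcongr
      exact hbi x
    · simpa using ((hlim x).norm.pow 2).mul_const (‖w x‖ ^ 2)
  have := hsq.sqrt
  simpa [Real.sqrt_sq (norm_nonneg _)] using this

end Multiplication

/-! ### Solutions and the consistency estimate -/

/-- The set where `‖q‖` exceeds its essential supremum is open and null, hence empty. -/
theorem norm_le_of_continuous_of_memLp_top {d : ℕ} {E : Type*} [NormedAddCommGroup E]
    {q : Rd d → E} (hq : MemLp q ∞ volume) (hc : Continuous q) :
    ∃ K : ℝ, 0 ≤ K ∧ ∀ x, ‖q x‖ ≤ K := by
  refine ⟨(eLpNorm q ∞ volume).toReal, ENNReal.toReal_nonneg, fun x => ?_⟩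
  by_contra! hx
  have hopen : IsOpen {x | (eLpNorm q ∞ volume).toReal < ‖q x‖} :=
    isOpen_lt continuous_const hc.norm
  refine (hopen.measure_pos volume ⟨x, hx⟩).ne' ?_
  have hae : ∀ᵐ x, ‖q x‖ ≤ (eLpNorm q ∞ volume).toReal := by
    filter_upwards [ae_le_eLpNormEssSup (f := q) (μ := volume)] with x hx
    rw [← eLpNorm_exponent_top] at hx
    rw [← toReal_enorm]
    exact ENNReal.toReal_mono hq.eLpNorm_ne_top hx
  simpa [ae_iff] using hae

variable {𝕜 : Type*} [RCLike 𝕜] {d : ℕ} {T : ℝ} {hT : 0 < T}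
  {L : L2 𝕜 d →ₗ.[𝕜] L2 𝕜 d} {q : Rd d → 𝕜} {f : C(Icc (0 : ℝ) T, L2 𝕜 d)} {g : L2 𝕜 d}
  {u : C(Icc (0 : ℝ) T, L2 𝕜 d)}

/-- A solution is continuously differentiable and satisfies the equation at every time. -/
theorem IsSolution.hasDerivWithinAt (hu : IsSolution hT L q f g u)
    {Q : Lp 𝕜 ∞ (volume : Measure (Rd d))}
    (hQ : Q =ᵐ[volume] q) {s : ℝ} (hs : s ∈ Ico 0 T) :
    HasDerivWithinAt (IccExtend hT.le u)
      (L ⟨u (projIcc 0 T hT.le s), hu.mem_domain _⟩ - (Q • IccExtend hT.le u s : L2 𝕜 d)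
        + IccExtend hT.le f s) (Ici s) s := by
  refine hasDerivWithinAt_of_ae_of_absolutelyContinuous
    (r := fun s => L ⟨u (projIcc 0 T hT.le s), hu.mem_domain _⟩
      - (Q • IccExtend hT.le u s : L2 𝕜 d) + IccExtend hT.le f s) ?_
    hu.absolutelyContinuous ?_ hs
  · exact ((hu.continuous_graph.comp continuous_projIcc).sub
      ((continuous_lp_smul Q).comp u.continuous.Icc_extend')).add f.continuous.Icc_extend'
  · filter_upwards [hu.equation] with t ht hmem
    obtain ⟨w, hw, heq⟩ := ht hmem
    refine hw.congr_deriv (Eq.symm ?_)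
    have hp : projIcc 0 T hT.le t = ⟨t, hmem⟩ := projIcc_of_mem _ hmem
    simp only [IccExtend, Function.comp_apply, hp]
    refine Lp.ext ?_
    filter_upwards [heq, hQ, Lp.coeFn_lpSMul (r := 2) Q (u ⟨t, hmem⟩),
      Lp.coeFn_add (L ⟨u ⟨t, hmem⟩, hu.mem_domain _⟩ - (Q • u ⟨t, hmem⟩ : L2 𝕜 d)) (f ⟨t, hmem⟩),
      Lp.coeFn_sub (L ⟨u ⟨t, hmem⟩, hu.mem_domain _⟩) (Q • u ⟨t, hmem⟩ : L2 𝕜 d)]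
      with x h1 h2 h3 h4 h5
    rw [h4, Pi.add_apply, h5, Pi.sub_apply, h3, Pi.smul_apply', h2, smul_eq_mul, ← h1]
    ring

/-- Stability of the solution with respect to the potential. -/
theorem IsSolution.norm_sub_le {S : ℝ≥0 → L2 𝕜 d →L[𝕜] L2 𝕜 d} (hS : IsC0Semigroup S)
    (hL : IsGenerator L S) {M : ℝ} (hM0 : 0 ≤ M) (hM : ∀ t ≤ T.toNNReal, ‖S t‖ ≤ M)
    {p : Rd d → 𝕜} {v : C(Icc (0 : ℝ) T, L2 𝕜 d)} (hu : IsSolution hT L p f g u)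
    (hv : IsSolution hT L q f g v) {P Q : Lp 𝕜 ∞ (volume : Measure (Rd d))}
    (hP : P =ᵐ[volume] p) (hQ : Q =ᵐ[volume] q) {K : ℝ} (hPK : ‖P‖ ≤ K) {A : ℝ}
    (hA : M * ∫ s in (0 : ℝ)..T, ‖((Q - P) • IccExtend hT.le v s : L2 𝕜 d)‖ ≤ A) :
    ‖u - v‖ ≤ A + M * K * gronwallBound 0 (M * K) A T := by
  have hK : 0 ≤ K := (norm_nonneg P).trans hPK
  set U := IccExtend hT.le u
  set V := IccExtend hT.le v
  have hUc : Continuous U := u.continuous.Icc_extend'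
  have hVc : Continuous V := v.continuous.Icc_extend'
  have hRc : Continuous fun s => ((Q - P) • V s : L2 𝕜 d) := (continuous_lp_smul _).comp hVc
  have hPc : Continuous fun s => (P • (U s - V s) : L2 𝕜 d) :=
    (continuous_lp_smul P).comp (hUc.sub hVc)
  have hbound : ∀ t ∈ Icc 0 T, ‖U t - V t‖ ≤ A + M * K * ∫ s in (0 : ℝ)..t, ‖U s - V s‖ := by
    intro t ht
    -- Writing `Q V - P U = (Q - P) V + P (U - V)` puts the error of the potential on `V` alone.
    have h1 := norm_le_integral_of_deriv_right hS hL hM (w := fun s => U s - V s)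
      (z := fun s => L ⟨u (projIcc 0 T hT.le s), hu.mem_domain _⟩
        - L ⟨v (projIcc 0 T hT.le s), hv.mem_domain _⟩)
      (y := fun s => ((Q - P) • V s : L2 𝕜 d) - (P • (U s - V s) : L2 𝕜 d)) ?_ (hUc.sub hVc)
      (hRc.sub hPc) ?_ ?_ ht
    · refine h1.trans ?_
      have hi1 : IntervalIntegrable (fun s => ‖((Q - P) • V s : L2 𝕜 d)‖) volume 0 t :=
        hRc.norm.intervalIntegrable _ _
      have hi2 : IntervalIntegrable (fun s => K * ‖U s - V s‖) volume 0 t :=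
        ((hUc.sub hVc).norm.const_mul K).intervalIntegrable _ _
      have h2 : ∫ s in (0 : ℝ)..t, ‖((Q - P) • V s : L2 𝕜 d) - (P • (U s - V s) : L2 𝕜 d)‖
          ≤ ∫ s in (0 : ℝ)..t, (‖((Q - P) • V s : L2 𝕜 d)‖ + K * ‖U s - V s‖) := by
        refine intervalIntegral.integral_mono_on ht.1
          ((hRc.sub hPc).norm.intervalIntegrable _ _) (hi1.add hi2) fun s _ => ?_
        refine (_root_.norm_sub_le _ _).trans (add_le_add_right ?_ _)
        exact (Lp.norm_smul_le _ _).trans (by gcongr)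
      rw [intervalIntegral.integral_add hi1 hi2, intervalIntegral.integral_const_mul] at h2
      have h3 : ∫ s in (0 : ℝ)..t, ‖((Q - P) • V s : L2 𝕜 d)‖
          ≤ ∫ s in (0 : ℝ)..T, ‖((Q - P) • V s : L2 𝕜 d)‖ :=
        intervalIntegral.integral_mono_interval le_rfl ht.1 ht.2
          (Eventually.of_forall fun _ => norm_nonneg _) (hRc.norm.intervalIntegrable _ _)
      calc _ ≤ M * ((∫ s in (0 : ℝ)..T, ‖((Q - P) • V s : L2 𝕜 d)‖)
            + K * ∫ s in (0 : ℝ)..t, ‖U s - V s‖) := by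
              gcongr
              exact h2.trans (by gcongr)
        _ ≤ _ := by rw [mul_add, mul_assoc]; gcongr
    · have h0 : projIcc 0 T hT.le 0 = ⟨0, left_mem_Icc.2 hT.le⟩ := projIcc_left _
      simp only [U, V, IccExtend, Function.comp_apply, h0, hu.initial, hv.initial, sub_self]
    · intro s _
      exact L.graph.sub_mem (L.mem_graph ⟨u (projIcc 0 T hT.le s), hu.mem_domain _⟩)
        (L.mem_graph ⟨v (projIcc 0 T hT.le s), hv.mem_domain _⟩)
    · intro s hs
      refine ((hu.hasDerivWithinAt hP hs).sub (hv.hasDerivWithinAt hQ hs)).congr_deriv ?_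
      have e1 : ((Q - P) • V s : L2 𝕜 d) = (Q • V s : L2 𝕜 d) - (P • V s : L2 𝕜 d) := by
        rw [sub_eq_add_neg, Lp.smul_add (r := 2), Lp.neg_smul, ← sub_eq_add_neg]
      have e2 : (P • (U s - V s) : L2 𝕜 d) = (P • U s : L2 𝕜 d) - (P • V s : L2 𝕜 d) := by
        rw [sub_eq_add_neg, Lp.add_smul (r := 2), Lp.smul_neg, ← sub_eq_add_neg]
      rw [e1, e2]
      abel
  have hle : ∀ t ∈ Icc 0 T, ‖U t - V t‖ ≤ A + M * K * gronwallBound 0 (M * K) A T :=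
    fun t ht => le_of_le_add_mul_integral (φ := fun t => ‖U t - V t‖) (hUc.sub hVc).norm
      (fun _ => norm_nonneg _) (by positivity) hbound ht
  have : Nonempty (Icc 0 T) := ⟨⟨0, left_mem_Icc.2 hT.le⟩⟩
  rw [ContinuousMap.norm_le_of_nonempty]
  intro t
  have := hle t t.2
  simpa [U, V] using this

/-- The source term produced by regularizing the potential tends to zero. -/
theorem tendsto_integral_norm_lp_smul_zero {ι : Type*} {l : Filter ι} [l.IsCountablyGenerated]
    {α : Type*} [MeasurableSpace α] {μ : Measure α}
    {Q : ι → Lp 𝕜 ∞ μ} {b : ι → α → 𝕜} (hQ : ∀ᶠ i in l, Q i =ᵐ[μ] b i) {K : ℝ}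
    (hb : ∀ᶠ i in l, ∀ x, ‖b i x‖ ≤ K) (hQK : ∀ᶠ i in l, ‖Q i‖ ≤ K)
    (hlim : ∀ x, Tendsto (fun i => b i x) l (𝓝 0)) {V : ℝ → Lp 𝕜 2 μ} (hV : Continuous V) (T : ℝ) :
    Tendsto (fun i => ∫ s in (0 : ℝ)..T, ‖(Q i • V s : Lp 𝕜 2 μ)‖) l (𝓝 0) := by
  suffices h : Tendsto (fun i => ∫ s in (0 : ℝ)..T, ‖(Q i • V s : Lp 𝕜 2 μ)‖) l
      (𝓝 (∫ _ in (0 : ℝ)..T, (0 : ℝ))) by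
    rwa [intervalIntegral.integral_zero] at h
  refine intervalIntegral.tendsto_integral_filter_of_dominated_convergence (fun s => K * ‖V s‖)
    (Eventually.of_forall fun i => ?_) ?_ ((hV.norm.const_mul K).intervalIntegrable (μ := volume) 0 T)
    (Eventually.of_forall fun s _ => tendsto_lp_smul_zero hQ hb hlim (V s))
  · exact ((continuous_lp_smul (Q i)).comp hV).norm.aestronglyMeasurable
  · filter_upwards [hQK] with i hi
    refine Eventually.of_forall fun s _ => ?_
    rw [norm_norm]
    exact (Lp.norm_smul_le _ _).trans (by gcongr)

end VeryWeak

theorem mainTheorem8 {𝕜 : Type*} [RCLike 𝕜] (d : ℕ) (T : ℝ) (hT : 0 < T)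
    (L : VeryWeak.L2 𝕜 d →ₗ.[𝕜] VeryWeak.L2 𝕜 d) (hL : VeryWeak.IsAdmissible L)
    (f : C(Set.Icc (0 : ℝ) T, VeryWeak.L2 𝕜 d)) (hf : ∃ K : ℝ≥0, LipschitzWith K f)
    (g : VeryWeak.L2 𝕜 d) (hg : g ∈ L.domain)
    (q : VeryWeak.Rd d → 𝕜) (hq_bdd : MemLp q ∞ volume) (hq_cont : Continuous q)
    (v : C(Set.Icc (0 : ℝ) T, VeryWeak.L2 𝕜 d)) (hv : VeryWeak.IsSolution hT L q f g v)
    (u : ℝ → C(Set.Icc (0 : ℝ) T, VeryWeak.L2 𝕜 d))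
    (hu : VeryWeak.IsVeryWeakSolution hT L q f g u) :
    Tendsto (fun ε : ℝ => ‖u ε - v‖) (𝓝[>] 0) (𝓝 0) := by
  obtain ⟨⟨φ, l, hφ, hl, hsol⟩, -⟩ := hu
  obtain ⟨S, hS, hgen⟩ := hL.generates
  obtain ⟨M, hM0, hM⟩ := hS.exists_bound T.toNNReal
  obtain ⟨K, hK0, hK⟩ := VeryWeak.norm_le_of_continuous_of_memLp_top hq_bdd hq_cont
  have hmem : ∀ᶠ ε in 𝓝[>] (0 : ℝ), ε ∈ Ioc (0 : ℝ) 1 := Ioc_mem_nhdsGT zero_lt_one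
  have hqε : ∀ ε ∈ Ioc (0 : ℝ) 1, MemLp (VeryWeak.regularizingNet q φ l ε) ∞ volume := fun ε hε =>
    memLp_top_of_bound
      (VeryWeak.continuous_regularizingNet hφ (hl.pos ε hε) hq_cont).aestronglyMeasurable K
      (Eventually.of_forall (VeryWeak.norm_regularizingNet_le hφ (hl.pos ε hε) hK))
  classical
  let P : ℝ → Lp 𝕜 ∞ (volume : Measure (VeryWeak.Rd d)) := fun ε =>
    -- The value `0` outside `(0,1]` is arbitrary; only small positive `ε` matter.
    if hε : ε ∈ Ioc (0 : ℝ) 1 then (hqε ε hε).toLp _ else 0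
  let Q : Lp 𝕜 ∞ (volume : Measure (VeryWeak.Rd d)) := hq_bdd.toLp q
  have hQ : Q =ᵐ[volume] q := hq_bdd.coeFn_toLp
  have hP : ∀ ε ∈ Ioc (0 : ℝ) 1, P ε =ᵐ[volume] VeryWeak.regularizingNet q φ l ε := fun ε hε => by
    simp only [P, dif_pos hε]
    exact (hqε ε hε).coeFn_toLp
  have hPK : ∀ ε ∈ Ioc (0 : ℝ) 1, ‖P ε‖ ≤ K := fun ε hε => by
    simp only [P, dif_pos hε]
    exact VeryWeak.norm_toLp_top_le _ hK0
      (VeryWeak.norm_regularizingNet_le hφ (hl.pos ε hε) hK)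
  have hQK : ‖Q‖ ≤ K := VeryWeak.norm_toLp_top_le _ hK0 hK
  have hint : Tendsto (fun ε => M * ∫ s in (0 : ℝ)..T,
      ‖((Q - P ε) • IccExtend hT.le v s : VeryWeak.L2 𝕜 d)‖) (𝓝[>] 0) (𝓝 0) := by
    have := VeryWeak.tendsto_integral_norm_lp_smul_zero (l := 𝓝[>] (0 : ℝ)) (K := K + K)
      (Q := fun ε => Q - P ε) (b := fun ε x => q x - VeryWeak.regularizingNet q φ l ε x)
      ?_ ?_ ?_ ?_ (V := IccExtend hT.le v) v.continuous.Icc_extend' T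
    · simpa using this.const_mul M
    · filter_upwards [hmem] with ε hε
      filter_upwards [hQ, hP ε hε, Lp.coeFn_sub Q (P ε)] with x h1 h2 h3
      rw [h3, Pi.sub_apply, h1, h2]
    · filter_upwards [hmem] with ε hε x
      exact (norm_sub_le _ _).trans (add_le_add (hK x)
        (VeryWeak.norm_regularizingNet_le hφ (hl.pos ε hε) hK x))
    · filter_upwards [hmem] with ε hε
      exact (norm_sub_le _ _).trans (add_le_add hQK (hPK ε hε))
    · intro x
      simpa using (VeryWeak.tendsto_regularizingNet hφ hl hq_cont x).const_sub (q x)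
  -- The stability bound is continuous in `A` and vanishes at `A = 0`.
  have hcont : Continuous fun A => A + M * K * gronwallBound 0 (M * K) A T :=
    continuous_id.add ((gronwallBound_continuous_ε 0 (M * K) T).const_mul _)
  have hlim := (hcont.tendsto 0).comp hint
  simp only [gronwallBound_ε0_δ0, mul_zero, add_zero] at hlim
  refine squeeze_zero' (Eventually.of_forall fun _ => norm_nonneg _) ?_ hlim
  filter_upwards [hmem] with ε hε
  exact (hsol ε hε).norm_sub_le hS hgen hM0 hM hv (hP ε hε) hQ (hPK ε hε) le_rfl
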